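/- Let $n\ge 1$, $r\ge 2$ and $k>r$ be integers, let $\Delta_n=\{x_j\}_{j=-k}^{n+k}$ be knots with $x_{-k}=\cdots=x_0=0<x_1<\cdots<x_n=\cdots=x_{n+k}=1$, and let $0<t\le 1/r$. For a function $g$ let $[y_0,\dots,y_m]g$ denote the divided difference, i.e. the coefficient of $y^m$ in the polynomial of degree at most $m$ that interpolates $g$ at $y_0,\dots,y_m$ (a node of multiplicity $\mu$ prescribes the left derivatives of orders $0,\dots,\mu-1$). Put $u_+^k=u^k$ for $u>0$ and $u_+^k=0$ for $u\le 0$. For $-k\le j\le n-1$ let $$N_{j,k}(x)=(x_{j+k+1}-x_j)\,[x_j,\dots,x_{j+k+1}](\cdot-x)_+^k,\qquad \xi_{j,k}=\frac{x_{j+1}+\cdots+x_{j+k}}{k},$$ and for $f\in C[0,1]$ (real-valued) let the variation-diminishing spline (Schoenberg) operator be $$S_{\Delta_n,k}f(x)=\sum_{j=-k}^{n-1}f(\xi_{j,k})\,N_{j,k}(x)\quad(0\le x<1),\qquad S_{\Delta_n,k}f(1)=\lim_{y\nearrow 1}S_{\Delta_n,k}f(y).$$ Let $$\omega_r(f,t)=\sup_{0<h<t}\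 \sup_{x\in[0,1-rh]}\Bigl|\sum_{l=0}^{r}(-1)^{r-l}\binom rl f(x+lh)\Bigr|,\qquad \|g\|_\infty=\sup_{x\in[0,1]}|g(x)|.$$ Then there is a constant $M>0$, independent of $f$, such that $$M\,\omega_r(f,t)\le\|f-S_{\Delta_n,k}f\|_\infty\qquad\text{for every } f\in C[0,1].$$ -/

import Mathlib

open Polynomial Set Filter Topology

noncomputable section

/-- `x` lists the knots `x_{-k} = ⋯ = x_0 = 0 < x_1 < ⋯ < x_n = ⋯ = x_{n+k} = 1`.
Values of `x` at indices outside `{-k, …, n+k}` play no role. -/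
structure IsKnotSequence (n k : ℕ) (x : ℤ → ℝ) : Prop where
  eq_zero : ∀ j : ℤ, -(k : ℤ) ≤ j → j ≤ 0 → x j = 0
  eq_one : ∀ j : ℤ, (n : ℤ) ≤ j → j ≤ (n : ℤ) + k → x j = 1
  lt_succ : ∀ j : ℤ, 0 ≤ j → j < n → x j < x (j + 1)

/-- The number of earlier nodes that coincide with the node `y i`. -/
def priorCount {m : ℕ} (y : Fin (m + 1) → ℝ) (i : Fin (m + 1)) : ℕ :=
  (Finset.univ.filter fun j => j < i ∧ y j = y i).card

/-- `p` is the polynomial of degree at most `m` that interpolates `f` at the `m + 1` nodes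
`y 0, …, y m`, where a node repeated `μ` times prescribes the derivatives of orders
`0, …, μ - 1`. Derivatives of `f` are taken from the left; this is the usual derivative wherever
that exists, and is the convention that makes B-splines right-continuous in their argument. -/
def Interpolates {m : ℕ} (y : Fin (m + 1) → ℝ) (f : ℝ → ℝ) (p : ℝ[X]) : Prop :=
  p.degree < ((m + 1 : ℕ) : WithBot ℕ) ∧
    ∀ i, (derivative^[priorCount y i] p).eval (y i)
      = iteratedDerivWithin (priorCount y i) f (Iic (y i)) (y i)

theorem eval_iterate_derivative_pow_mul (z : ℝ) (l : ℕ) (g : ℝ[X]) :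
    (derivative^[l] ((X - C z) ^ l * g)).eval z = (l.factorial : ℝ) * g.eval z := by
  have h1 : (hasseDeriv l ((X - C z) ^ l * g)).eval z = g.eval z := by
    rw [← taylor_coeff, taylor_mul, taylor_pow]
    have : taylor z (X - C z) = X := by simp
    rw [this]
    have := coeff_X_pow_mul (taylor z g) l 0
    rw [Nat.zero_add] at this
    rw [this, taylor_coeff_zero]
  rw [← h1, ← factorial_smul_hasseDeriv]
  simp

theorem eq_zero_of_interpolation {m : ℕ} (y : Fin (m + 1) → ℝ) (p : ℝ[X])
    (hd : p.degree < ((m + 1 : ℕ) : WithBot ℕ))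
    (h : ∀ i, (derivative^[priorCount y i] p).eval (y i) = 0) : p = 0 := by
  have key : ∀ s : ℕ, s ≤ m + 1 →
      (∏ i ∈ Finset.univ.filter (fun i : Fin (m + 1) => (i : ℕ) < s), (X - C (y i))) ∣ p := by
    intro s
    induction s with
    | zero => intro _; simp
    | succ s ih =>
      intro hs
      obtain ⟨q, hq⟩ := ih (by omega)
      set a : Fin (m + 1) := ⟨s, by omega⟩ with ha
      have hins : Finset.univ.filter (fun i : Fin (m + 1) => (i : ℕ) < s + 1)
          = insert a (Finset.univ.filter (fun i : Fin (m + 1) => (i : ℕ) < s)) := by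
        ext i
        simp only [Finset.mem_filter, Finset.mem_univ, true_and, Finset.mem_insert, ha, Fin.ext_iff]
        omega
      rw [hins, Finset.prod_insert (by simp [ha])]
      set R : ℝ[X] := ∏ i ∈ (Finset.univ.filter (fun i : Fin (m + 1) => (i : ℕ) < s)).filter
        (fun i => ¬ y i = y a), (X - C (y i)) with hR
      have hsplit : (∏ i ∈ Finset.univ.filter (fun i : Fin (m + 1) => (i : ℕ) < s), (X - C (y i)))
          = (X - C (y a)) ^ priorCount y a * R := by
        rw [← Finset.prod_filter_mul_prod_filter_not _ (fun i => y i = y a)]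
        congr 1
        rw [Finset.prod_congr rfl (g := fun _ => X - C (y a))
          (fun i hi => by rw [(Finset.mem_filter.1 hi).2]), Finset.prod_const, Finset.filter_filter]
        rfl
      have hRne : R.eval (y a) ≠ 0 := by
        rw [hR, eval_prod, Finset.prod_ne_zero_iff]
        intro i hi
        have := (Finset.mem_filter.1 hi).2
        simpa [sub_eq_zero] using fun e => this e.symm
      have h0 := h a
      rw [hq, hsplit, mul_assoc, eval_iterate_derivative_pow_mul, eval_mul] at h0
      have hq0 : q.eval (y a) = 0 := by
        have := Nat.factorial_ne_zero (priorCount y a)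
        simpa [hRne, this] using h0
      obtain ⟨q', hq'⟩ := dvd_iff_isRoot.2 hq0
      exact ⟨q', by rw [hq, hq']; ring⟩
  by_contra hp
  have hdvd := degree_le_of_dvd (key (m + 1) le_rfl) hp
  rw [Finset.filter_true_of_mem (fun i _ => i.2), degree_prod] at hdvd
  simp only [degree_X_sub_C, Finset.sum_const, Finset.card_univ, Fintype.card_fin,
    nsmul_eq_mul, mul_one] at hdvd
  exact absurd hd (not_lt.2 hdvd)

theorem existsUnique_interpolates {m : ℕ} (y : Fin (m + 1) → ℝ) (f : ℝ → ℝ) :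
    ∃! p : ℝ[X], Interpolates y f p := by
  let L : degreeLT ℝ (m + 1) →ₗ[ℝ] (Fin (m + 1) → ℝ) :=
    LinearMap.pi fun i => ((leval (y i)) ∘ₗ (derivative ^ priorCount y i)) ∘ₗ
      (degreeLT ℝ (m + 1)).subtype
  have hL : ∀ p i, L p i = (derivative^[priorCount y i] (p : ℝ[X])).eval (y i) := by
    intro p i
    simp [L, Module.End.pow_apply]
  have hinj : Function.Injective L := by
    rw [← LinearMap.ker_eq_bot, LinearMap.ker_eq_bot']
    intro p hp
    apply Subtype.ext
    exact eq_zero_of_interpolation y p (mem_degreeLT.1 p.2) fun i => by rw [← hL, hp]; rfl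
  have : FiniteDimensional ℝ (degreeLT ℝ (m + 1)) :=
    (degreeLTEquiv ℝ (m + 1)).symm.finiteDimensional
  have hsurj : Function.Surjective L :=
    (LinearMap.injective_iff_surjective_of_finrank_eq_finrank
      (degreeLTEquiv ℝ (m + 1)).finrank_eq).1 hinj
  obtain ⟨p, hp⟩ := hsurj fun i => iteratedDerivWithin (priorCount y i) f (Iic (y i)) (y i)
  refine ⟨p, ⟨mem_degreeLT.1 p.2, fun i => by rw [← hL, hp]⟩, fun q hq => ?_⟩
  have : L ⟨q, mem_degreeLT.2 hq.1⟩ = L p := by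
    rw [hp]; funext i; rw [hL]; exact hq.2 i
  exact congrArg Subtype.val (hinj this)

/-- The interpolation polynomial of `f` at the nodes `y 0, …, y m`. -/
def interpolant {m : ℕ} (y : Fin (m + 1) → ℝ) (f : ℝ → ℝ) : ℝ[X] :=
  (existsUnique_interpolates y f).choose

/-- The divided difference `[y 0, …, y m] f`: the coefficient of `X ^ m` in the interpolation
polynomial of degree at most `m`. -/
def dividedDifference {m : ℕ} (y : Fin (m + 1) → ℝ) (f : ℝ → ℝ) : ℝ :=
  (interpolant y f).coeff m

/-- The truncated power `u_+^k`. -/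
def truncatedPower (k : ℕ) (u : ℝ) : ℝ :=
  if 0 < u then u ^ k else 0

/-- The normalized B-spline
`N_{j,k}(s) = (x_{j+k+1} - x_j) [x_j, …, x_{j+k+1}] (· - s)_+^k`. -/
def bSpline (k : ℕ) (x : ℤ → ℝ) (j : ℤ) (s : ℝ) : ℝ :=
  (x (j + k + 1) - x j) *
    dividedDifference (m := k + 1) (fun i => x (j + (i : ℕ))) fun u => truncatedPower k (u - s)

/-- The Greville node `ξ_{j,k} = (x_{j+1} + ⋯ + x_{j+k}) / k`. -/
def grevilleNode (k : ℕ) (x : ℤ → ℝ) (j : ℤ) : ℝ :=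
  (∑ i ∈ Finset.Icc 1 k, x (j + (i : ℕ))) / k

/-- The sum `∑_{j=-k}^{n-1} f(ξ_{j,k}) N_{j,k}(s)`. -/
def schoenbergSum (n k : ℕ) (x : ℤ → ℝ) (f : ℝ → ℝ) (s : ℝ) : ℝ :=
  ∑ j ∈ Finset.Ico (-(k : ℤ)) n, f (grevilleNode k x j) * bSpline k x j s

/-- The variation-diminishing spline (Schoenberg) operator on `[0, 1]`: the sum above on `[0, 1)`,
and its left limit at `1`. -/
def schoenberg (n k : ℕ) (x : ℤ → ℝ) (f : ℝ → ℝ) (s : ℝ) : ℝ :=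
  if s < 1 then schoenbergSum n k x f s else limUnder (𝓝[<] (1 : ℝ)) (schoenbergSum n k x f)

/-- The forward difference of order `r` with step `h`. -/
def forwardDifference (r : ℕ) (h : ℝ) (f : ℝ → ℝ) (s : ℝ) : ℝ :=
  ∑ l ∈ Finset.range (r + 1), (-1 : ℝ) ^ (r - l) * (r.choose l : ℝ) * f (s + l * h)

/-- The `r`-th modulus of smoothness on `[0, 1]`. -/
def modulusOfSmoothness (r : ℕ) (f : ℝ → ℝ) (t : ℝ) : ℝ :=
  sSup {v | ∃ h ∈ Ioo 0 t, ∃ s ∈ Icc 0 (1 - r * h), v = |forwardDifference r h f s|}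

/-- The supremum norm on `[0, 1]`. -/
def uniformNorm (g : ℝ → ℝ) : ℝ :=
  sSup ((fun s => |g s|) '' Icc 0 1)

end

/-!
The operator `S` reproduces affine functions and has finite rank, and the functions it fixes are
exactly the affine ones. Hence `f - S f` controls the distance of `f` to the affine functions, and
this distance controls every difference of order `r ≥ 2`, which annihilates affine functions.

Concretely, `S f = ∑ f (ξ_j) W_j` with weights `W_j` that are nonnegative, sum to `1` and satisfy
`∑ ξ_j W_j(s) = s`. Evaluating `g = f - S f` at the nodes shows that the vector `(f (ξ_j))` is mapped
by `1 - A`, with the collocation matrix `A = (W_j (ξ_i))`, to `(g (ξ_i))`. The kernel of `1 - A`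
consists of the affine functions of the nodes (`IsKnotSequence.exists_affine_of_fixed`), by a maximum
principle for the stochastic matrix `A`: for interior `i` its entry at `(i, i - 1)` is positive,
because `ξ_i` lies in the interior of the support of the B-spline with index `i - 1`. A linear
right inverse of `1 - A` on its range then gives an affine function `p` with
`‖f - p‖ ≤ (1 + K) ‖g‖` (`IsKnotSequence.exists_affine_approx`).

The properties of B-splines are derived from divided differences of `(· - s)_+^e`. With derivatives
taken from the left, this function has at a node `y` the jet of `0` if `y ≤ s` and that of
`(X - s)^e` if `y > s`. Thus Hermite interpolation is a pair of congruences, modulo the coprime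
products of the factors `X - y` over the nodes of either kind (`MatchesTruncatedPower`), and the
recursion of divided differences, Leibniz' rule and the Cox–de Boor recurrence become polynomial
identities that need no case distinction for coinciding knots. The partition of unity and the
reproduction of linear functions are telescoping sums; together with nonnegativity they also give
the limit of `S f` at the right end point.
-/

noncomputable section

/-! ### Divided differences of truncated powers -/

theorem iteratedDeriv_polynomial_eval (q : ℝ[X]) (c : ℕ) (a : ℝ) :
    iteratedDeriv c (fun u => q.eval u) a = (derivative^[c] q).eval a := by
  induction c generalizing q with
  | zero => simp
  | succ c ih =>
    rw [iteratedDeriv_succ', Function.iterate_succ_apply, ← ih]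
    congr 1
    funext u
    exact q.deriv

/-- Approaching a node from the left, the truncated power is a polynomial near the node: zero if
the node is at most `s`, and `(X - s) ^ e` otherwise. -/
theorem iteratedDerivWithin_truncatedPower (e c : ℕ) (s a : ℝ) :
    iteratedDerivWithin c (fun u => truncatedPower e (u - s)) (Iic a) a
      = (derivative^[c] (if a ≤ s then 0 else (X - C s) ^ e : ℝ[X])).eval a := by
  set q : ℝ[X] := if a ≤ s then 0 else (X - C s) ^ e with hq
  have hev : (fun u => truncatedPower e (u - s)) =ᶠ[𝓝[Iic a] a] fun u => q.eval u := by
    by_cases h : a ≤ s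
    · filter_upwards [self_mem_nhdsWithin] with u hu
      have hu' : u ≤ a := hu
      simp [truncatedPower, hq, h, not_lt.2 (hu'.trans h)]
    · filter_upwards [mem_nhdsWithin_of_mem_nhds (lt_mem_nhds (not_le.1 h))] with u hu
      simp [truncatedPower, hq, h, hu]
  rw [← iteratedDeriv_polynomial_eval, iteratedDerivWithin,
    hev.iteratedFDerivWithin_eq (hev.eq_of_nhdsWithin self_mem_Iic), ← iteratedDerivWithin]
  have hsm : ContDiff ℝ c fun u => q.eval u := by
    simpa only [coe_aeval_eq_eval] using q.contDiff_aeval (𝕜 := ℝ) c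
  exact iteratedDerivWithin_eq_iteratedDeriv (uniqueDiffOn_Iic a)
    hsm.contDiffAt self_mem_Iic

variable {ι : Type*}

/-- The product of the factors `X - y i` over the nodes `y i ≤ s`, where `(· - s)_+^e` has a
vanishing left jet. -/
def lowFactor (y : ι → ℝ) (s : ℝ) (I : Finset ι) : ℝ[X] :=
  ∏ i ∈ I with y i ≤ s, (X - C (y i))

/-- The product of the factors `X - y i` over the nodes `y i > s`, where `(· - s)_+^e` has the left
jet of `(X - s) ^ e`. -/
def highFactor (y : ι → ℝ) (s : ℝ) (I : Finset ι) : ℝ[X] :=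
  ∏ i ∈ I with ¬ y i ≤ s, (X - C (y i))

/-- The Hermite interpolation conditions for `(· - s)_+^e` at the nodes `y i`, `i ∈ I`, expressed
as congruences. -/
def MatchesTruncatedPower (y : ι → ℝ) (s : ℝ) (e : ℕ) (I : Finset ι) (p : ℝ[X]) : Prop :=
  lowFactor y s I ∣ p ∧ highFactor y s I ∣ p - (X - C s) ^ e

theorem lowFactor_mul_highFactor (y : ι → ℝ) (s : ℝ) (I : Finset ι) :
    lowFactor y s I * highFactor y s I = ∏ i ∈ I, (X - C (y i)) :=
  Finset.prod_filter_mul_prod_filter_not _ _ _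

theorem isCoprime_lowFactor_highFactor (y : ι → ℝ) (s : ℝ) (I : Finset ι) :
    IsCoprime (lowFactor y s I) (highFactor y s I) := by
  refine IsCoprime.prod_left fun i hi => IsCoprime.prod_right fun j hj => ?_
  have h1 := (Finset.mem_filter.1 hi).2
  have h2 := not_le.1 (Finset.mem_filter.1 hj).2
  exact isCoprime_X_sub_C_of_isUnit_sub (sub_ne_zero_of_ne (h1.trans_lt h2).ne).isUnit

theorem MatchesTruncatedPower.mono {y : ι → ℝ} {s : ℝ} {e : ℕ} {I J : Finset ι} {p : ℝ[X]}
    (h : MatchesTruncatedPower y s e J p) (hIJ : I ⊆ J) : MatchesTruncatedPower y s e I p :=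
  ⟨(Finset.prod_dvd_prod_of_subset _ _ _ (Finset.filter_subset_filter _ hIJ)).trans h.1,
    (Finset.prod_dvd_prod_of_subset _ _ _ (Finset.filter_subset_filter _ hIJ)).trans h.2⟩

theorem MatchesTruncatedPower.dvd_sub {y : ι → ℝ} {s : ℝ} {e : ℕ} {I : Finset ι} {p q : ℝ[X]}
    (hp : MatchesTruncatedPower y s e I p) (hq : MatchesTruncatedPower y s e I q) :
    ∏ i ∈ I, (X - C (y i)) ∣ p - q := by
  rw [← lowFactor_mul_highFactor y s]
  refine (isCoprime_lowFactor_highFactor y s I).mul_dvd (_root_.dvd_sub hp.1 hq.1) ?_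
  have := _root_.dvd_sub hp.2 hq.2
  rwa [sub_sub_sub_cancel_right] at this

theorem MatchesTruncatedPower.add_mul_prod {y : ι → ℝ} {s : ℝ} {e : ℕ} {I : Finset ι} {p : ℝ[X]}
    (hp : MatchesTruncatedPower y s e I p) (q : ℝ[X]) :
    MatchesTruncatedPower y s e I (p + (∏ i ∈ I, (X - C (y i))) * q) := by
  rw [← lowFactor_mul_highFactor y s]
  refine ⟨dvd_add hp.1 (Dvd.intro _ (mul_assoc _ _ _).symm), ?_⟩
  rw [add_sub_right_comm]
  exact dvd_add hp.2 (Dvd.intro (lowFactor y s I * q) (by ring))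

theorem MatchesTruncatedPower.mul_X_sub_C {y : ι → ℝ} {s : ℝ} {e : ℕ} {I : Finset ι} {p : ℝ[X]}
    (hp : MatchesTruncatedPower y s e I p) :
    MatchesTruncatedPower y s (e + 1) I ((X - C s) * p) := by
  refine ⟨dvd_mul_of_dvd_right hp.1 _, ?_⟩
  rw [pow_succ', ← mul_sub]
  exact dvd_mul_of_dvd_right hp.2 _

theorem matchesTruncatedPower_zero {y : ι → ℝ} {s : ℝ} (e : ℕ) {I : Finset ι}
    (h : ∀ i ∈ I, y i ≤ s) : MatchesTruncatedPower y s e I 0 := by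
  refine ⟨dvd_zero _, ?_⟩
  rw [highFactor, Finset.filter_false_of_mem fun i hi => not_not.2 (h i hi)]
  simp

theorem matchesTruncatedPower_pow {y : ι → ℝ} {s : ℝ} (e : ℕ) {I : Finset ι}
    (h : ∀ i ∈ I, s < y i) : MatchesTruncatedPower y s e I ((X - C s) ^ e) := by
  refine ⟨?_, by simp⟩
  rw [lowFactor, Finset.filter_false_of_mem fun i hi => not_le.2 (h i hi)]
  simp

theorem exists_matchesTruncatedPower (y : ι → ℝ) (s : ℝ) (e : ℕ) (I : Finset ι) :
    ∃ p : ℝ[X], p.degree < (I.card : WithBot ℕ) ∧ MatchesTruncatedPower y s e I p := by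
  obtain ⟨u, v, huv⟩ := isCoprime_lowFactor_highFactor y s I
  have hm : (∏ i ∈ I, (X - C (y i))).Monic := monic_prod_X_sub_C _ _
  -- The Chinese remainder theorem gives a solution `p` of the congruences; it is then reduced
  -- modulo the nodal polynomial.
  set p := u * lowFactor y s I * (X - C s) ^ e with hp
  have h0 : MatchesTruncatedPower y s e I p := by
    refine ⟨Dvd.intro_left (u * (X - C s) ^ e) (by rw [hp]; ring),
      Dvd.intro_left (-(v * (X - C s) ^ e)) ?_⟩
    rw [hp]
    linear_combination -(X - C s) ^ e * huv
  refine ⟨p %ₘ ∏ i ∈ I, (X - C (y i)), ?_, ?_⟩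
  · have := degree_modByMonic_lt p hm
    rwa [degree_prod_of_monic _ _ fun i _ => monic_X_sub_C _, Finset.sum_congr rfl
      (fun i _ => degree_X_sub_C _), Finset.sum_const, nsmul_one] at this
  · have := h0.add_mul_prod (-(p /ₘ ∏ i ∈ I, (X - C (y i))))
    rwa [mul_neg, ← sub_eq_add_neg, ← modByMonic_eq_sub_mul_div] at this

theorem eval_iterate_derivative_eq_zero_of_pow_dvd {q : ℝ[X]} {a : ℝ} {c N : ℕ}
    (h : (X - C a) ^ N ∣ q) (hc : c < N) : (derivative^[c] q).eval a = 0 := by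
  have h1 : X - C a ∣ derivative^[c] q :=
    (dvd_pow_self _ (Nat.sub_ne_zero_of_lt hc)).trans
      (pow_sub_dvd_iterate_derivative_of_pow_dvd c h)
  exact dvd_iff_isRoot.1 h1

theorem priorCount_lt_card {m : ℕ} (y : Fin (m + 1) → ℝ) (i : Fin (m + 1)) :
    priorCount y i < (Finset.univ.filter fun j => y j = y i).card := by
  refine Finset.card_lt_card ⟨fun j hj => ?_, fun h => ?_⟩
  · simp only [Finset.mem_filter, Finset.mem_univ, true_and] at hj ⊢
    exact hj.2
  · have := h (show i ∈ Finset.univ.filter (fun j => y j = y i) by simp)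
    simp at this

theorem pow_dvd_prod_filter {m : ℕ} (y : Fin (m + 1) → ℝ) (i : Fin (m + 1)) (P : ℝ → Prop)
    [DecidablePred P] (hi : P (y i)) :
    (X - C (y i)) ^ (Finset.univ.filter fun j => y j = y i).card
      ∣ ∏ j with P (y j), (X - C (y j)) := by
  rw [← Finset.prod_const, Finset.prod_congr rfl
    (g := fun j => X - C (y j)) (fun j hj => by rw [(Finset.mem_filter.1 hj).2])]
  refine Finset.prod_dvd_prod_of_subset _ _ _ fun j hj => ?_
  simp only [Finset.mem_filter, Finset.mem_univ, true_and] at hj ⊢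
  rwa [hj]

theorem MatchesTruncatedPower.interpolates {m : ℕ} {y : Fin (m + 1) → ℝ} {s : ℝ} {e : ℕ}
    {p : ℝ[X]} (hd : p.degree < ((m + 1 : ℕ) : WithBot ℕ))
    (hp : MatchesTruncatedPower y s e Finset.univ p) :
    Interpolates y (fun u => truncatedPower e (u - s)) p := by
  refine ⟨hd, fun i => ?_⟩
  rw [iteratedDerivWithin_truncatedPower, ← sub_eq_zero, ← eval_sub,
    ← iterate_derivative_sub]
  refine eval_iterate_derivative_eq_zero_of_pow_dvd ?_ (priorCount_lt_card y i)
  split_ifs with h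
  · rw [sub_zero]
    exact (pow_dvd_prod_filter y i (fun z => z ≤ s) h).trans hp.1
  · exact (pow_dvd_prod_filter y i (fun z => ¬ z ≤ s) h).trans hp.2

/-- The interpolation polynomial of `(· - s)_+^e` at the knots `x a, …, x (a + m)`. -/
def windowInterpolant (x : ℤ → ℝ) (s : ℝ) (e : ℕ) (a : ℤ) (m : ℕ) : ℝ[X] :=
  interpolant (m := m) (fun i => x (a + (i : ℕ))) fun u => truncatedPower e (u - s)

/-- The divided difference of `(· - s)_+^e` at the knots `x a, …, x (a + m)`. -/
def windowDifference (x : ℤ → ℝ) (s : ℝ) (e : ℕ) (a : ℤ) (m : ℕ) : ℝ :=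
  (windowInterpolant x s e a m).coeff m

theorem prod_window {x : ℤ → ℝ} (P : ℝ → Prop) [DecidablePred P] (a : ℤ) (m : ℕ) :
    ∏ i ∈ Finset.Icc a (a + m) with P (x i), (X - C (x i))
      = ∏ i ∈ Finset.univ.filter (fun i : Fin (m + 1) => P (x (a + ((i : ℕ) : ℤ)))),
          (X - C (x (a + ((i : ℕ) : ℤ)))) := by
  symm
  refine Finset.prod_bij (fun i _ => a + ((i : ℕ) : ℤ)) ?_ ?_ ?_ ?_
  · intro i hi
    simp only [Finset.mem_filter, Finset.mem_univ, true_and, Finset.mem_Icc] at hi ⊢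
    exact ⟨by omega, hi⟩
  · intro i _ j _ h
    ext; omega
  · intro j hj
    simp only [Finset.mem_filter, Finset.mem_Icc] at hj
    refine ⟨⟨(j - a).toNat, by omega⟩, ?_, ?_⟩
    · have : a + ((j - a).toNat : ℤ) = j := by omega
      simpa only [Finset.mem_filter, Finset.mem_univ, true_and, this] using hj.2
    · simp only; omega
  · intro i _; rfl

theorem windowInterpolant_eq {x : ℤ → ℝ} {s : ℝ} {e : ℕ} {a : ℤ} {m : ℕ} {p : ℝ[X]}
    (hd : p.degree < ((m + 1 : ℕ) : WithBot ℕ))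
    (hp : MatchesTruncatedPower x s e (Finset.Icc a (a + m)) p) :
    windowInterpolant x s e a m = p := by
  refine (existsUnique_interpolates _ _).unique
    (existsUnique_interpolates _ _).choose_spec.1 ?_
  refine MatchesTruncatedPower.interpolates hd ?_
  simpa only [MatchesTruncatedPower, lowFactor, highFactor, prod_window (fun z => z ≤ s),
    prod_window (fun z => ¬ z ≤ s)] using hp

theorem windowInterpolant_spec (x : ℤ → ℝ) (s : ℝ) (e : ℕ) (a : ℤ) (m : ℕ) :
    (windowInterpolant x s e a m).degree < ((m + 1 : ℕ) : WithBot ℕ) ∧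
      MatchesTruncatedPower x s e (Finset.Icc a (a + m)) (windowInterpolant x s e a m) := by
  obtain ⟨p, hd, hp⟩ := exists_matchesTruncatedPower x s e (Finset.Icc a (a + m))
  have hc : (Finset.Icc a (a + m)).card = m + 1 := by rw [Int.card_Icc]; omega
  rw [hc] at hd
  rw [windowInterpolant_eq hd hp]
  exact ⟨hd, hp⟩

/-- A polynomial of degree at most `N` divisible by `N` linear factors is a multiple of their
product by its coefficient of order `N`. -/
theorem eq_C_coeff_mul_prod {y : ι → ℝ} {I : Finset ι} {q : ℝ[X]}
    (hd : q.degree < ((I.card + 1 : ℕ) : WithBot ℕ)) (h : ∏ i ∈ I, (X - C (y i)) ∣ q) :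
    q = C (q.coeff I.card) * ∏ i ∈ I, (X - C (y i)) := by
  have hm : (∏ i ∈ I, (X - C (y i))).Monic := monic_prod_X_sub_C _ _
  have hn : (∏ i ∈ I, (X - C (y i))).natDegree = I.card := by
    rw [natDegree_prod_of_monic _ _ fun i _ => monic_X_sub_C _]; simp
  obtain ⟨g, rfl⟩ := h
  have hg : g.natDegree = 0 := by
    by_cases h0 : g = 0
    · simp [h0]
    have h1 := natDegree_lt_iff_degree_lt (mul_ne_zero hm.ne_zero h0) |>.2 hd
    rw [hm.natDegree_mul' h0, hn] at h1
    omega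
  obtain ⟨b, rfl⟩ := natDegree_eq_zero.1 hg
  rw [mul_comm, coeff_C_mul, ← hn, hm.coeff_natDegree, mul_one]

theorem card_Icc_window (a : ℤ) (m : ℕ) : (Finset.Icc a (a + m)).card = m + 1 := by
  rw [Int.card_Icc]; omega

/-- Dropping the last knot changes the interpolation polynomial by a multiple of the nodal
polynomial of the remaining knots (Newton's form). -/
theorem windowInterpolant_sub_left (x : ℤ → ℝ) (s : ℝ) (e : ℕ) (a : ℤ) (m : ℕ) :
    windowInterpolant x s e a (m + 1) - windowInterpolant x s e a m
      = C (windowDifference x s e a (m + 1)) * ∏ i ∈ Finset.Icc a (a + m), (X - C (x i)) := by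
  obtain ⟨h1, h2⟩ := windowInterpolant_spec x s e a (m + 1)
  obtain ⟨h3, h4⟩ := windowInterpolant_spec x s e a m
  have h := (h2.mono (I := Finset.Icc a (a + m))
    (Finset.Icc_subset_Icc le_rfl (by push_cast; omega))).dvd_sub h4
  have h5 := h3.trans_le (Nat.cast_le.2 (Nat.le_succ (m + 1)))
  rw [eq_C_coeff_mul_prod (by
    rw [card_Icc_window]; exact (degree_sub_le _ _).trans_lt (max_lt h1 h5)) h]
  rw [card_Icc_window, coeff_sub, coeff_eq_zero_of_degree_lt h3, sub_zero, windowDifference]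

/-- Dropping the first knot changes the interpolation polynomial by a multiple of the nodal
polynomial of the remaining knots. -/
theorem windowInterpolant_sub_right (x : ℤ → ℝ) (s : ℝ) (e : ℕ) (a : ℤ) (m : ℕ) :
    windowInterpolant x s e a (m + 1) - windowInterpolant x s e (a + 1) m
      = C (windowDifference x s e a (m + 1))
        * ∏ i ∈ Finset.Icc (a + 1) (a + 1 + m), (X - C (x i)) := by
  obtain ⟨h1, h2⟩ := windowInterpolant_spec x s e a (m + 1)
  obtain ⟨h3, h4⟩ := windowInterpolant_spec x s e (a + 1) m
  have h := (h2.mono (I := Finset.Icc (a + 1) (a + 1 + m))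
    (Finset.Icc_subset_Icc (by omega) (by push_cast; omega))).dvd_sub h4
  have h5 := h3.trans_le (Nat.cast_le.2 (Nat.le_succ (m + 1)))
  rw [eq_C_coeff_mul_prod (by
    rw [card_Icc_window]; exact (degree_sub_le _ _).trans_lt (max_lt h1 h5)) h]
  rw [card_Icc_window, coeff_sub, coeff_eq_zero_of_degree_lt h3, sub_zero, windowDifference]

theorem coeff_prod_X_sub_C_card (y : ι → ℝ) (I : Finset ι) :
    (∏ i ∈ I, (X - C (y i))).coeff I.card = 1 := by
  have hm : (∏ i ∈ I, (X - C (y i))).Monic := monic_prod_X_sub_C _ _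
  have hn : (∏ i ∈ I, (X - C (y i))).natDegree = I.card := by
    rw [natDegree_prod_of_monic _ _ fun i _ => monic_X_sub_C _]; simp
  rw [← hn, hm.coeff_natDegree]

/-- The recursion of divided differences; it holds for coinciding knots too. -/
theorem windowDifference_recursion (x : ℤ → ℝ) (s : ℝ) (e : ℕ) (a : ℤ) (m : ℕ) :
    (x (a + 1 + m) - x a) * windowDifference x s e a (m + 1)
      = windowDifference x s e (a + 1) m - windowDifference x s e a m := by
  have h1 := windowInterpolant_sub_left x s e a m
  have h2 := windowInterpolant_sub_right x s e a m
  -- Both nodal polynomials contain the nodal polynomial `Q` of the `m` inner knots.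
  set Q : ℝ[X] := ∏ i ∈ Finset.Ioc a (a + m), (X - C (x i)) with hQ
  have hl : ∏ i ∈ Finset.Icc a (a + m), (X - C (x i)) = (X - C (x a)) * Q := by
    rw [hQ, ← Finset.Ioc_insert_left (by omega), Finset.prod_insert (by simp)]
  have hr : ∏ i ∈ Finset.Icc (a + 1) (a + 1 + m), (X - C (x i)) = (X - C (x (a + 1 + m))) * Q := by
    have : Finset.Icc (a + 1) (a + 1 + m) = insert (a + 1 + (m : ℤ)) (Finset.Ioc a (a + m)) := by
      ext i; simp only [Finset.mem_Icc, Finset.mem_insert, Finset.mem_Ioc]; omega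
    rw [this, Finset.prod_insert (by simp only [Finset.mem_Ioc]; omega)]
  rw [hl] at h1
  rw [hr] at h2
  have hcQ : Q.coeff m = 1 := by
    have := coeff_prod_X_sub_C_card x (Finset.Ioc a (a + m))
    rwa [Int.card_Ioc, add_sub_cancel_left, Int.toNat_natCast] at this
  have h3 : windowInterpolant x s e (a + 1) m - windowInterpolant x s e a m
      = C ((x (a + 1 + m) - x a) * windowDifference x s e a (m + 1)) * Q := by
    rw [C_mul, C_sub]
    linear_combination h1 - h2
  have h4 := congrArg (fun p => p.coeff m) h3
  simp only [coeff_sub, coeff_C_mul, hcQ, mul_one] at h4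
  rw [← h4, windowDifference, windowDifference]

/-- Leibniz' rule for the product of `(· - s)_+^e` with the linear function `· - s`. -/
theorem windowDifference_leibniz (x : ℤ → ℝ) (s : ℝ) (e : ℕ) (a : ℤ) (m : ℕ) :
    windowDifference x s (e + 1) a (m + 1)
      = (x (a + 1 + m) - s) * windowDifference x s e a (m + 1) + windowDifference x s e a m := by
  have h1 := windowInterpolant_sub_left x s e a m
  obtain ⟨-, h2⟩ := windowInterpolant_spec x s e a (m + 1)
  obtain ⟨h3, -⟩ := windowInterpolant_spec x s e a m
  set c := windowDifference x s e a (m + 1) with hc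
  set p := windowInterpolant x s e a m with hp
  set Q : ℝ[X] := ∏ i ∈ Finset.Icc a (a + m), (X - C (x i)) with hQ
  have hI : ∏ i ∈ Finset.Icc a (a + (m + 1 : ℕ)), (X - C (x i)) = (X - C (x (a + 1 + m))) * Q := by
    have : Finset.Icc a (a + (m + 1 : ℕ)) = insert (a + 1 + (m : ℤ)) (Finset.Icc a (a + m)) := by
      ext i; simp only [Finset.mem_Icc, Finset.mem_insert]; push_cast; omega
    rw [this, Finset.prod_insert (by simp only [Finset.mem_Icc]; omega)]
  have hcQ : Q.coeff (m + 1) = 1 := by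
    have := coeff_prod_X_sub_C_card x (Finset.Icc a (a + m))
    rwa [card_Icc_window] at this
  have hdQ : Q.degree < ((m + 1 + 1 : ℕ) : WithBot ℕ) := by
    rw [hQ, degree_prod_of_monic _ _ fun i _ => monic_X_sub_C _, Finset.sum_congr rfl
      (fun i _ => degree_X_sub_C _), Finset.sum_const, nsmul_one, card_Icc_window]
    exact Nat.cast_lt.2 (Nat.lt_succ_self _)
  -- `(X - s) P`, with `P` the interpolation polynomial at all `m + 2` knots, has degree one too
  -- high; subtracting `c` times the nodal polynomial corrects this.
  have hmatch := h2.mul_X_sub_C.add_mul_prod (-C c)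
  have heq : (X - C s) * windowInterpolant x s e a (m + 1)
      + (∏ i ∈ Finset.Icc a (a + (m + 1 : ℕ)), (X - C (x i))) * -C c
      = (X - C s) * p + C (c * (x (a + 1 + m) - s)) * Q := by
    rw [hI, C_mul, C_sub]
    linear_combination (X - C s) * h1
  rw [heq] at hmatch
  have hdp : ((X - C s) * p).degree < ((m + 1 + 1 : ℕ) : WithBot ℕ) := by
    rw [degree_lt_iff_coeff_zero] at h3 ⊢
    rintro (_ | j) hj
    · omega
    · rw [sub_mul, coeff_sub, coeff_X_mul, coeff_C_mul, h3 j (by omega), h3 (j + 1) (by omega)]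
      ring
  have hdeg : ((X - C s) * p + C (c * (x (a + 1 + m) - s)) * Q).degree
      < ((m + 1 + 1 : ℕ) : WithBot ℕ) := by
    refine (degree_add_le _ _).trans_lt (max_lt hdp ?_)
    rw [← smul_eq_C_mul]
    exact (degree_smul_le _ _).trans_lt hdQ
  rw [windowDifference, windowInterpolant_eq hdeg hmatch, coeff_add, coeff_C_mul, hcQ, sub_mul,
    coeff_sub, coeff_X_mul, coeff_C_mul, coeff_eq_zero_of_degree_lt h3, windowDifference, ← hp]
  ring

theorem windowDifference_eq_zero {x : ℤ → ℝ} {s : ℝ} (e : ℕ) {a : ℤ} {m : ℕ}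
    (h : ∀ i ∈ Finset.Icc a (a + m), x i ≤ s) : windowDifference x s e a m = 0 := by
  rw [windowDifference, windowInterpolant_eq (p := 0) (by simp [bot_lt_iff_ne_bot])
    (matchesTruncatedPower_zero e h), coeff_zero]

theorem degree_X_sub_C_pow_lt (s : ℝ) {e m : ℕ} (he : e ≤ m) :
    ((X - C s : ℝ[X]) ^ e).degree < ((m + 1 : ℕ) : WithBot ℕ) := by
  rw [degree_pow, degree_X_sub_C, nsmul_one]
  exact Nat.cast_lt.2 (Nat.lt_succ_of_le he)

theorem windowDifference_self {x : ℤ → ℝ} {s : ℝ} {a : ℤ} {m : ℕ}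
    (h : ∀ i ∈ Finset.Icc a (a + m), s < x i) : windowDifference x s m a m = 1 := by
  rw [windowDifference, windowInterpolant_eq (degree_X_sub_C_pow_lt s le_rfl)
    (matchesTruncatedPower_pow m h)]
  simpa using ((monic_X_sub_C s).pow m).coeff_natDegree

theorem windowDifference_eq_zero_of_lt {x : ℤ → ℝ} {s : ℝ} {e : ℕ} {a : ℤ} {m : ℕ} (he : e < m)
    (h : ∀ i ∈ Finset.Icc a (a + m), s < x i) : windowDifference x s e a m = 0 := by
  rw [windowDifference, windowInterpolant_eq (degree_X_sub_C_pow_lt s he.le)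
    (matchesTruncatedPower_pow e h)]
  exact coeff_eq_zero_of_natDegree_lt (by simpa using he)

/-- With all knots equal to `b > s`, the interpolation polynomial of `(· - s)_+^(m+1)` is
`(X - s)^(m+1) - (X - b)^(m+1)`. -/
theorem windowDifference_succ_of_eq {x : ℤ → ℝ} {s b : ℝ} {a : ℤ} {m : ℕ} (hs : s < b)
    (h : ∀ i ∈ Finset.Icc a (a + m), x i = b) :
    windowDifference x s (m + 1) a m = (m + 1) * (b - s) := by
  have hQ : ∏ i ∈ Finset.Icc a (a + m), (X - C (x i)) = (X - C b : ℝ[X]) ^ (m + 1) := by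
    rw [Finset.prod_congr rfl fun i hi => by rw [h i hi], Finset.prod_const, card_Icc_window]
  have h1 := (matchesTruncatedPower_pow (m + 1) (s := s)
    (fun i hi => by rw [h i hi]; exact hs)).add_mul_prod (y := x) (I := Finset.Icc a (a + m)) (-1)
  rw [hQ, mul_neg_one, ← sub_eq_add_neg] at h1
  have hdeg : ((X - C s : ℝ[X]) ^ (m + 1) - (X - C b) ^ (m + 1)).degree
      < ((m + 1 : ℕ) : WithBot ℕ) := by
    have := degree_sub_lt_left (p := (X - C s : ℝ[X]) ^ (m + 1)) (q := (X - C b) ^ (m + 1))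
      (by simp) (pow_ne_zero _ (X_sub_C_ne_zero s)) (by simp)
    rwa [degree_pow, degree_X_sub_C, nsmul_one] at this
  have hco : ∀ z : ℝ, ((X - C z : ℝ[X]) ^ (m + 1)).coeff m = -z * (m + 1) := by
    intro z
    rw [sub_eq_add_neg, ← C_neg, coeff_X_add_C_pow]
    simp
  rw [windowDifference, windowInterpolant_eq hdeg h1, coeff_sub, hco, hco]
  ring

/-! ### B-splines: recurrence, sign and support -/

theorem bSpline_eq_windowDifference (k : ℕ) (x : ℤ → ℝ) (j : ℤ) (s : ℝ) :
    bSpline k x j s = (x (j + k + 1) - x j) * windowDifference x s k j (k + 1) := rfl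

theorem bSpline_eq_sub (k : ℕ) (x : ℤ → ℝ) (j : ℤ) (s : ℝ) :
    bSpline k x j s = windowDifference x s k (j + 1) k - windowDifference x s k j k := by
  rw [bSpline_eq_windowDifference, ← windowDifference_recursion, add_right_comm]

/-- The Cox–de Boor recurrence, for the divided differences underlying the B-splines. -/
theorem windowDifference_cox_deBoor (x : ℤ → ℝ) (s : ℝ) (k : ℕ) (a : ℤ) :
    (x (a + 1 + (k + 1 : ℕ)) - x a) * windowDifference x s (k + 1) a (k + 2)
      = (x (a + 1 + (k + 1 : ℕ)) - s) * windowDifference x s k (a + 1) (k + 1)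
        + (s - x a) * windowDifference x s k a (k + 1) := by
  linear_combination (x (a + 1 + (k + 1 : ℕ)) - x a) * windowDifference_leibniz x s k a (k + 1)
    + (x (a + 1 + (k + 1 : ℕ)) - s) * windowDifference_recursion x s k a (k + 1)

theorem windowDifference_of_le_lt {x : ℤ → ℝ} {s : ℝ} {a : ℤ} (h0 : x a ≤ s)
    (h1 : s < x (a + 1)) : 0 < windowDifference x s 0 a 1 := by
  have h := windowDifference_recursion x s 0 a 0
  rw [windowDifference_self (a := a + 1) (m := 0) (by simpa using h1),
    windowDifference_eq_zero (a := a) (m := 0) 0 (by simpa using h0)] at h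
  simp only [Nat.cast_zero, add_zero, zero_add, sub_zero] at h
  exact pos_of_mul_pos_right (h ▸ one_pos) (sub_pos.2 (h0.trans_lt h1)).le

theorem windowDifference_eq_zero_of_outside {x : ℤ → ℝ} {s : ℝ} {k : ℕ} {a : ℤ}
    (hx : MonotoneOn x (Icc a (a + k + 1))) (h : s < x a ∨ x (a + k + 1) ≤ s) :
    windowDifference x s k a (k + 1) = 0 := by
  have hmem : ∀ i ∈ Finset.Icc a (a + (k + 1 : ℕ)), i ∈ Icc a (a + k + 1) := by
    intro i hi
    rw [Finset.mem_Icc] at hi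
    push_cast at hi
    exact ⟨hi.1, by omega⟩
  rcases h with h | h
  · exact windowDifference_eq_zero_of_lt (Nat.lt_succ_self k) fun i hi =>
      h.trans_le (hx ⟨le_rfl, by omega⟩ (hmem i hi) (hmem i hi).1)
  · exact windowDifference_eq_zero k fun i hi =>
      (hx (hmem i hi) ⟨by omega, le_rfl⟩ (hmem i hi).2).trans h

theorem windowDifference_nonneg (x : ℤ → ℝ) (s : ℝ) (k : ℕ) (a : ℤ)
    (hx : MonotoneOn x (Icc a (a + k + 1))) : 0 ≤ windowDifference x s k a (k + 1) := by
  induction k generalizing a with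
  | zero =>
    by_cases h : s < x a ∨ x (a + (0 : ℕ) + 1) ≤ s
    · exact (windowDifference_eq_zero_of_outside hx h).ge
    · push Not at h
      exact (windowDifference_of_le_lt h.1 (by simpa using h.2)).le
  | succ k ih =>
    by_cases h : s < x a ∨ x (a + (k + 1 : ℕ) + 1) ≤ s
    · exact (windowDifference_eq_zero_of_outside hx h).ge
    push Not at h
    obtain ⟨h0, h1⟩ := h
    have hr := windowDifference_cox_deBoor x s k a
    have he : a + 1 + ((k + 1 : ℕ) : ℤ) = a + (k + 1 : ℕ) + 1 := by ring
    rw [he] at hr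
    have := add_nonneg
      (mul_nonneg (sub_nonneg.2 h1.le) (ih (a + 1)
        (hx.mono (Icc_subset_Icc (by omega) (by push_cast; omega)))))
      (mul_nonneg (sub_nonneg.2 h0) (ih a
        (hx.mono (Icc_subset_Icc le_rfl (by push_cast; omega)))))
    rw [← hr] at this
    exact nonneg_of_mul_nonneg_right this (sub_pos.2 (h0.trans_lt h1))

/-- The second alternative in `h` (all knots but the last coincide with `s`) is needed for the
induction: there the spline jumps at `s`, and its value is the limit from the right. -/
theorem windowDifference_pos (x : ℤ → ℝ) (s : ℝ) (k : ℕ) (a : ℤ)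
    (hx : MonotoneOn x (Icc a (a + k + 1))) (h0 : x a ≤ s) (h1 : s < x (a + k + 1))
    (h : x a < s ∨ x (a + k) ≤ s) : 0 < windowDifference x s k a (k + 1) := by
  induction k generalizing a with
  | zero => exact windowDifference_of_le_lt h0 (by simpa using h1)
  | succ k ih =>
    have hr := windowDifference_cox_deBoor x s k a
    have he : a + 1 + ((k + 1 : ℕ) : ℤ) = a + (k + 1 : ℕ) + 1 := by ring
    rw [he] at hr
    have hxl : MonotoneOn x (Icc a (a + k + 1)) :=
      hx.mono (Icc_subset_Icc le_rfl (by push_cast; omega))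
    have hxr : MonotoneOn x (Icc (a + 1) (a + 1 + k + 1)) :=
      hx.mono (Icc_subset_Icc (by omega) (by push_cast; omega))
    have hl := windowDifference_nonneg x s k a hxl
    have hr' := windowDifference_nonneg x s k (a + 1) hxr
    have e1 : a + 1 + (k : ℤ) + 1 = a + (k + 1 : ℕ) + 1 := by push_cast; ring
    have e2 : a + 1 + (k : ℤ) = a + (k + 1 : ℕ) := by push_cast; ring
    have e3 : a + (k : ℤ) + 1 = a + (k + 1 : ℕ) := by push_cast; ring
    have hmono : x (a + 1) ≤ x (a + (k + 1 : ℕ)) :=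
      hx ⟨by omega, by push_cast; omega⟩ ⟨by omega, by omega⟩ (by push_cast; omega)
    suffices hs : 0 < (x (a + (k + 1 : ℕ) + 1) - s) * windowDifference x s k (a + 1) (k + 1)
        + (s - x a) * windowDifference x s k a (k + 1) by
      rw [← hr] at hs
      exact pos_of_mul_pos_right hs (sub_pos.2 (h0.trans_lt h1)).le
    rcases lt_or_ge s (x (a + (k + 1 : ℕ))) with h2 | h2
    · have h3 : x a < s := h.resolve_right (not_le.2 h2)
      exact add_pos_of_nonneg_of_pos (mul_nonneg (sub_nonneg.2 h1.le) hr')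
        (mul_pos (sub_pos.2 h3) (ih a hxl h0 (by rwa [e3]) (Or.inl h3)))
    · exact add_pos_of_pos_of_nonneg (mul_pos (sub_pos.2 h1)
        (ih (a + 1) hxr (hmono.trans h2) (by rwa [e1]) (Or.inr (by rwa [e2]))))
        (mul_nonneg (sub_nonneg.2 h0) hl)

/-! ### The knots and the Greville nodes -/

section Knots

variable {n k : ℕ} {x : ℤ → ℝ}

theorem IsKnotSequence.le_succ (hx : IsKnotSequence n k x) {j : ℤ} (h0 : -(k : ℤ) ≤ j)
    (h1 : j < n + k) : x j ≤ x (j + 1) := by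
  rcases lt_or_ge j 0 with h | h
  · rw [hx.eq_zero j h0 h.le, hx.eq_zero (j + 1) (by omega) (by omega)]
  rcases lt_or_ge j n with h' | h'
  · exact (hx.lt_succ j h h').le
  · rw [hx.eq_one j h' h1.le, hx.eq_one (j + 1) (by omega) (by omega)]

theorem IsKnotSequence.monotoneOn (hx : IsKnotSequence n k x) :
    MonotoneOn x (Icc (-(k : ℤ)) (n + k)) := by
  intro i hi j hj hij
  obtain ⟨d, rfl⟩ := Int.le.dest hij
  clear hij
  induction d with
  | zero => simp
  | succ d ih =>
    obtain ⟨hi0, hi1⟩ := hi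
    obtain ⟨hj0, hj1⟩ := hj
    push_cast at hj1 ⊢
    have := hx.le_succ (j := i + d) (by omega) (by omega)
    rw [← add_assoc]
    exact (ih ⟨by omega, by omega⟩).trans this

theorem IsKnotSequence.nonneg (hx : IsKnotSequence n k x) {j : ℤ} (h0 : -(k : ℤ) ≤ j)
    (h1 : j ≤ n + k) : 0 ≤ x j := by
  rw [← hx.eq_zero (-k) le_rfl (by omega)]
  exact hx.monotoneOn ⟨le_rfl, by omega⟩ ⟨h0, h1⟩ h0

theorem IsKnotSequence.le_one (hx : IsKnotSequence n k x) {j : ℤ} (h0 : -(k : ℤ) ≤ j)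
    (h1 : j ≤ n + k) : x j ≤ 1 := by
  rw [← hx.eq_one (n + k) (by omega) le_rfl]
  exact hx.monotoneOn ⟨h0, h1⟩ ⟨by omega, le_rfl⟩ h1

theorem IsKnotSequence.pos (hx : IsKnotSequence n k x) (hn : 0 < n) {j : ℤ} (h0 : 1 ≤ j)
    (h1 : j ≤ n + k) : 0 < x j := by
  have h := hx.lt_succ 0 le_rfl (by omega)
  rw [hx.eq_zero 0 (by omega) le_rfl, zero_add] at h
  exact h.trans_le (hx.monotoneOn ⟨by omega, by omega⟩ ⟨by omega, h1⟩ h0)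

theorem IsKnotSequence.lt_one (hx : IsKnotSequence n k x) (hn : 0 < n) {j : ℤ}
    (h0 : -(k : ℤ) ≤ j) (h1 : j < n) : x j < 1 := by
  have h := hx.lt_succ (n - 1) (by omega) (by omega)
  rw [sub_add_cancel, hx.eq_one n le_rfl (by omega)] at h
  exact (hx.monotoneOn ⟨h0, by omega⟩ ⟨by omega, by omega⟩ (by omega)).trans_lt h

theorem IsKnotSequence.lt_of_interior (hx : IsKnotSequence n k x) (hn : 0 < n) (hk : 2 ≤ k) {j : ℤ}
    (h0 : -(k : ℤ) < j) (h1 : j < n - 1) : x (j + 1) < x (j + k) := by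
  rcases le_or_gt (j + 1) 0 with h | h
  · rw [hx.eq_zero (j + 1) (by omega) h]
    exact hx.pos hn (by omega) (by omega)
  · exact (hx.lt_succ (j + 1) h.le (by omega)).trans_le
      (hx.monotoneOn ⟨by omega, by omega⟩ ⟨by omega, by omega⟩ (by omega))

theorem grevilleNode_eq_of_forall (hk : 0 < k) {j : ℤ} {b : ℝ}
    (h : ∀ i ∈ Finset.Icc 1 k, x (j + (i : ℕ)) = b) : grevilleNode k x j = b := by
  rw [grevilleNode, Finset.sum_congr rfl h, Finset.sum_const, Nat.card_Icc, nsmul_eq_mul,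
    Nat.add_sub_cancel, mul_div_cancel_left₀]
  exact_mod_cast hk.ne'

theorem IsKnotSequence.grevilleNode_first (hx : IsKnotSequence n k x) (hk : 0 < k) :
    grevilleNode k x (-k) = 0 := by
  refine grevilleNode_eq_of_forall hk fun i hi => hx.eq_zero _ ?_ ?_ <;>
    · rw [Finset.mem_Icc] at hi; omega

theorem IsKnotSequence.grevilleNode_last (hx : IsKnotSequence n k x) (hk : 0 < k) :
    grevilleNode k x (n - 1) = 1 := by
  refine grevilleNode_eq_of_forall hk fun i hi => hx.eq_one _ ?_ ?_ <;>
    · rw [Finset.mem_Icc] at hi; omega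

theorem IsKnotSequence.grevilleNode_mem (hx : IsKnotSequence n k x) (hk : 0 < k) {j : ℤ}
    (h0 : -(k : ℤ) ≤ j) (h1 : j < n) : grevilleNode k x j ∈ Icc (0 : ℝ) 1 := by
  have hk' : (0 : ℝ) < k := by exact_mod_cast hk
  constructor
  · refine div_nonneg (Finset.sum_nonneg fun i hi => ?_) hk'.le
    rw [Finset.mem_Icc] at hi
    exact hx.nonneg (by omega) (by omega)
  · rw [grevilleNode, div_le_one hk']
    have := Finset.sum_le_card_nsmul (Finset.Icc 1 k) (fun i : ℕ => x (j + (i : ℕ))) 1 fun i hi => by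
      rw [Finset.mem_Icc] at hi
      exact hx.le_one (by omega) (by omega)
    simpa using this

/-- For `-k < j < n - 1` the node `ξ_j` lies strictly between two knots inside the support
`[x_{j-1}, x_{j+k}]` of the B-spline with index `j - 1`. -/
theorem IsKnotSequence.lt_grevilleNode_lt (hx : IsKnotSequence n k x) (hn : 0 < n) (hk : 2 ≤ k)
    {j : ℤ} (h0 : -(k : ℤ) < j) (h1 : j < n - 1) :
    x (j + 1) < grevilleNode k x j ∧ grevilleNode k x j < x (j + k) := by
  have hlt := hx.lt_of_interior hn hk h0 h1
  have hk' : (0 : ℝ) < k := by exact_mod_cast (by omega : 0 < k)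
  have hc : ∀ b : ℝ, ∑ _i ∈ Finset.Icc 1 k, b = b * k := fun b => by
    rw [Finset.sum_const, Nat.card_Icc, nsmul_eq_mul, Nat.add_sub_cancel, mul_comm]
  rw [grevilleNode, lt_div_iff₀ hk', div_lt_iff₀ hk', ← hc, ← hc]
  have hmono : ∀ i ∈ Finset.Icc 1 k, x (j + 1) ≤ x (j + (i : ℕ)) ∧ x (j + (i : ℕ)) ≤ x (j + k) := by
    intro i hi
    rw [Finset.mem_Icc] at hi
    exact ⟨hx.monotoneOn ⟨by omega, by omega⟩ ⟨by omega, by omega⟩ (by omega),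
      hx.monotoneOn ⟨by omega, by omega⟩ ⟨by omega, by omega⟩ (by omega)⟩
  exact ⟨Finset.sum_lt_sum (fun i hi => (hmono i hi).1)
      ⟨k, Finset.mem_Icc.2 ⟨by omega, le_rfl⟩, hlt⟩,
    Finset.sum_lt_sum (fun i hi => (hmono i hi).2)
      ⟨1, Finset.mem_Icc.2 ⟨le_rfl, by omega⟩, by simpa using hlt⟩⟩

theorem IsKnotSequence.grevilleNode_lt_one (hx : IsKnotSequence n k x) (hn : 0 < n) (hk : 2 ≤ k)
    {j : ℤ} (h0 : -(k : ℤ) ≤ j) (h1 : j < n - 1) : grevilleNode k x j < 1 := by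
  rcases h0.eq_or_lt with rfl | h0
  · rw [hx.grevilleNode_first (by omega)]; exact one_pos
  · exact (hx.lt_grevilleNode_lt hn hk h0 h1).2.trans_le (hx.le_one (by omega) (by omega))

theorem grevilleNode_sub (hk : 0 < k) (j : ℤ) :
    k * (grevilleNode k x j - grevilleNode k x (j - 1)) = x (j + k) - x j := by
  have hk' : (k : ℝ) ≠ 0 := by exact_mod_cast hk.ne'
  have h : ∀ b : ℤ, k * grevilleNode k x b = ∑ i ∈ Finset.range k, x (b + (i + 1 : ℕ)) := by
    intro b
    rw [grevilleNode, mul_div_cancel₀ _ hk', Finset.range_eq_Ico, Finset.sum_Ico_add'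
      (fun i : ℕ => x (b + (i : ℕ))) 0 k 1]
    rfl
  rw [mul_sub, h, h, ← Finset.sum_sub_distrib]
  have := Finset.sum_range_sub (fun i : ℕ => x (j + (i : ℕ))) k
  rw [Nat.cast_zero, add_zero] at this
  rw [← this]
  refine Finset.sum_congr rfl fun i _ => ?_
  rw [show j - 1 + ((i + 1 : ℕ) : ℤ) = j + i by push_cast; ring]

/-! ### Partition of unity and reproduction of linear functions -/

theorem sum_Ico_int_sub (F : ℤ → ℝ) (a : ℤ) (N : ℕ) :
    ∑ j ∈ Finset.Ico a (a + N), (F (j + 1) - F j) = F (a + N) - F a := by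
  induction N with
  | zero => simp
  | succ N ih =>
    have : Finset.Ico a (a + (N + 1 : ℕ)) = insert (a + (N : ℤ)) (Finset.Ico a (a + N)) := by
      ext i; simp only [Finset.mem_Ico, Finset.mem_insert]; push_cast; omega
    rw [this, Finset.sum_insert (by simp), ih]
    push_cast
    rw [← add_assoc]
    ring

theorem sum_Ico_neg_sub (F : ℤ → ℝ) (n k : ℕ) :
    ∑ j ∈ Finset.Ico (-(k : ℤ)) n, (F (j + 1) - F j) = F n - F (-k) := by
  have := sum_Ico_int_sub F (-k) (n + k)
  rwa [show -(k : ℤ) + (n + k : ℕ) = n by push_cast; ring] at this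

theorem IsKnotSequence.windowDifference_first (hx : IsKnotSequence n k x) {s : ℝ} (hs : 0 ≤ s)
    (e : ℕ) {m : ℕ} (hm : m ≤ k) : windowDifference x s e (-k) m = 0 := by
  refine windowDifference_eq_zero e fun i hi => ?_
  rw [Finset.mem_Icc] at hi
  rwa [hx.eq_zero i hi.1 (by omega)]

theorem IsKnotSequence.windowDifference_last (hx : IsKnotSequence n k x) {s : ℝ} (hs : s < 1) :
    windowDifference x s k n k = 1 := by
  refine windowDifference_self fun i hi => ?_
  rw [Finset.mem_Icc] at hi
  rwa [hx.eq_one i hi.1 hi.2]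

theorem IsKnotSequence.sum_bSpline (hx : IsKnotSequence n k x) {s : ℝ} (h0 : 0 ≤ s)
    (h1 : s < 1) : ∑ j ∈ Finset.Ico (-(k : ℤ)) n, bSpline k x j s = 1 := by
  simp only [bSpline_eq_sub]
  rw [sum_Ico_neg_sub (fun j => windowDifference x s k j k), hx.windowDifference_last h1,
    hx.windowDifference_first h0 k le_rfl, sub_zero]

/-- Reproduction of linear functions. Since `k (ξ_j - ξ_{j-1}) = x_{j+k} - x_j`, summation by parts
turns the sum into a telescoping one. -/
theorem IsKnotSequence.sum_grevilleNode_mul_bSpline (hx : IsKnotSequence n k x) (hk : 0 < k)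
    {s : ℝ} (h0 : 0 ≤ s) (h1 : s < 1) :
    ∑ j ∈ Finset.Ico (-(k : ℤ)) n, grevilleNode k x j * bSpline k x j s = s := by
  obtain ⟨m, rfl⟩ : ∃ m, k = m + 1 := ⟨k - 1, by omega⟩
  have hk' : ((m + 1 : ℕ) : ℝ) ≠ 0 := by exact_mod_cast hk.ne'
  set D : ℤ → ℝ := fun j => windowDifference x s (m + 1) j (m + 1) with hD
  set E : ℤ → ℝ := fun j => windowDifference x s (m + 1) j m with hE
  set G : ℤ → ℝ := fun j => grevilleNode (m + 1) x (j - 1) * D j - E j / (m + 1 : ℕ) with hG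
  have hterm : ∀ j, grevilleNode (m + 1) x j * bSpline (m + 1) x j s = G (j + 1) - G j := by
    intro j
    have e1 : E (j + 1) - E j
        = (m + 1 : ℕ) * (grevilleNode (m + 1) x j - grevilleNode (m + 1) x (j - 1)) * D j := by
      rw [grevilleNode_sub hk, hD, hE]
      simp only
      rw [← windowDifference_recursion]
      congr 3
      push_cast; ring_nf
    rw [bSpline_eq_sub]
    simp only [hG, add_sub_cancel_right]
    change grevilleNode (m + 1) x j * (D (j + 1) - D j) = _
    field_simp
    linear_combination e1
  rw [Finset.sum_congr rfl fun j _ => hterm j, sum_Ico_neg_sub]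
  have hE1 : E n = (m + 1) * (1 - s) := by
    refine windowDifference_succ_of_eq h1 fun i hi => ?_
    rw [Finset.mem_Icc] at hi
    exact hx.eq_one i hi.1 (by push_cast; omega)
  simp only [hG, hE1]
  rw [show D n = 1 from hx.windowDifference_last h1,
    show D (-(m + 1 : ℕ)) = 0 from hx.windowDifference_first h0 _ le_rfl,
    show E (-(m + 1 : ℕ)) = 0 from hx.windowDifference_first h0 _ (by omega),
    hx.grevilleNode_last hk]
  push_cast at hk' ⊢
  field_simp
  ring

theorem IsKnotSequence.bSpline_nonneg (hx : IsKnotSequence n k x) {j : ℤ} (h0 : -(k : ℤ) ≤ j)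
    (h1 : j < n) (s : ℝ) : 0 ≤ bSpline k x j s :=
  mul_nonneg (sub_nonneg.2 (hx.monotoneOn ⟨h0, by omega⟩ ⟨by omega, by omega⟩ (by omega)))
    (windowDifference_nonneg x s k j (hx.monotoneOn.mono (Icc_subset_Icc h0 (by omega))))

theorem IsKnotSequence.bSpline_pos (hx : IsKnotSequence n k x) {j : ℤ} (h0 : -(k : ℤ) ≤ j)
    (h1 : j < n) {s : ℝ} (h2 : x j < s) (h3 : s < x (j + k + 1)) : 0 < bSpline k x j s :=
  mul_pos (sub_pos.2 (h2.trans h3)) (windowDifference_pos x s k j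
    (hx.monotoneOn.mono (Icc_subset_Icc h0 (by omega))) h2.le h3 (Or.inl h2))

end Knots

/-! ### The Schoenberg operator in terms of its weights -/

section Weights

variable {n k : ℕ} {x : ℤ → ℝ}

/-- The coefficient of `f (ξ_{j,k})` in the Schoenberg operator at `s ∈ [0, 1]`: the B-spline for
`s < 1`, and its left limit at `s = 1`, which is `1` for `j = n - 1` and `0` otherwise. -/
def schoenbergWeight (n k : ℕ) (x : ℤ → ℝ) (j : ℤ) (s : ℝ) : ℝ :=
  if s < 1 then bSpline k x j s else if j = n - 1 then 1 else 0

theorem IsKnotSequence.schoenbergWeight_nonneg (hx : IsKnotSequence n k x) {j : ℤ}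
    (hj : j ∈ Finset.Ico (-(k : ℤ)) n) (s : ℝ) : 0 ≤ schoenbergWeight n k x j s := by
  rw [Finset.mem_Ico] at hj
  rw [schoenbergWeight]
  split_ifs
  exacts [hx.bSpline_nonneg hj.1 hj.2 s, zero_le_one, le_rfl]

theorem schoenbergWeight_one (j : ℤ) :
    schoenbergWeight n k x j 1 = if j = n - 1 then 1 else 0 := by simp [schoenbergWeight]

theorem schoenbergWeight_of_lt (j : ℤ) {s : ℝ} (hs : s < 1) :
    schoenbergWeight n k x j s = bSpline k x j s := by simp [schoenbergWeight, hs]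

theorem sum_mul_schoenbergWeight_one (hn : 0 < n) (c : ℤ → ℝ) :
    ∑ j ∈ Finset.Ico (-(k : ℤ)) n, c j * schoenbergWeight n k x j 1 = c (n - 1) := by
  simp only [schoenbergWeight_one, mul_ite, mul_one, mul_zero]
  rw [Finset.sum_ite_eq', if_pos (Finset.mem_Ico.2 ⟨by omega, by omega⟩)]

theorem IsKnotSequence.sum_schoenbergWeight (hx : IsKnotSequence n k x) (hn : 0 < n) {s : ℝ}
    (hs : s ∈ Icc (0 : ℝ) 1) : ∑ j ∈ Finset.Ico (-(k : ℤ)) n, schoenbergWeight n k x j s = 1 := by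
  rcases hs.2.eq_or_lt with rfl | h
  · simpa using sum_mul_schoenbergWeight_one (k := k) (x := x) hn fun _ => 1
  · simp only [schoenbergWeight_of_lt _ h]
    exact hx.sum_bSpline hs.1 h

theorem IsKnotSequence.sum_grevilleNode_mul_schoenbergWeight (hx : IsKnotSequence n k x)
    (hn : 0 < n) (hk : 0 < k) {s : ℝ} (hs : s ∈ Icc (0 : ℝ) 1) :
    ∑ j ∈ Finset.Ico (-(k : ℤ)) n, grevilleNode k x j * schoenbergWeight n k x j s = s := by
  rcases hs.2.eq_or_lt with rfl | h
  · rw [sum_mul_schoenbergWeight_one hn, hx.grevilleNode_last hk]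
  · simp only [schoenbergWeight_of_lt _ h]
    exact hx.sum_grevilleNode_mul_bSpline hk hs.1 h

theorem IsKnotSequence.abs_sum_mul_schoenbergWeight_le (hx : IsKnotSequence n k x) (hn : 0 < n)
    {c : ℤ → ℝ} {B : ℝ} (hc : ∀ j ∈ Finset.Ico (-(k : ℤ)) n, |c j| ≤ B) {s : ℝ}
    (hs : s ∈ Icc (0 : ℝ) 1) :
    |∑ j ∈ Finset.Ico (-(k : ℤ)) n, c j * schoenbergWeight n k x j s| ≤ B := by
  refine (Finset.abs_sum_le_sum_abs _ _).trans ?_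
  rw [← mul_one B, ← hx.sum_schoenbergWeight hn hs, Finset.mul_sum]
  refine Finset.sum_le_sum fun j hj => ?_
  rw [abs_mul, abs_of_nonneg (hx.schoenbergWeight_nonneg hj s)]
  exact mul_le_mul_of_nonneg_right (hc j hj) (hx.schoenbergWeight_nonneg hj s)

/-- Since `∑ (1 - ξ_i) N_i(s) = 1 - s` has nonnegative terms, every B-spline but the last tends
to `0` at the right end point. -/
theorem IsKnotSequence.tendsto_bSpline (hx : IsKnotSequence n k x) (hn : 0 < n) (hk : 2 ≤ k)
    {j : ℤ} (h0 : -(k : ℤ) ≤ j) (h1 : j < n - 1) :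
    Tendsto (bSpline k x j) (𝓝[<] 1) (𝓝 0) := by
  have hξ : 0 < 1 - grevilleNode k x j := sub_pos.2 (hx.grevilleNode_lt_one hn hk h0 h1)
  have hlim : Tendsto (fun s : ℝ => (1 - s) / (1 - grevilleNode k x j)) (𝓝[<] 1) (𝓝 0) := by
    have : ContinuousAt (fun s : ℝ => (1 - s) / (1 - grevilleNode k x j)) 1 := by fun_prop
    simpa using this.tendsto.mono_left nhdsWithin_le_nhds
  refine tendsto_of_tendsto_of_tendsto_of_le_of_le' tendsto_const_nhds hlim
    (Eventually.of_forall fun s => hx.bSpline_nonneg h0 (by omega) s) ?_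
  filter_upwards [Ico_mem_nhdsLT (zero_lt_one (α := ℝ))] with s hs
  rw [le_div_iff₀ hξ, mul_comm]
  have hsum : ∑ i ∈ Finset.Ico (-(k : ℤ)) n, (1 - grevilleNode k x i) * bSpline k x i s
      = 1 - s := by
    simp only [sub_mul, one_mul]
    rw [Finset.sum_sub_distrib, hx.sum_bSpline hs.1 hs.2,
      hx.sum_grevilleNode_mul_bSpline (by omega) hs.1 hs.2]
  rw [← hsum]
  refine Finset.single_le_sum (f := fun i => (1 - grevilleNode k x i) * bSpline k x i s)
    (fun i hi => ?_) (Finset.mem_Ico.2 ⟨h0, by omega⟩)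
  rw [Finset.mem_Ico] at hi
  exact mul_nonneg (sub_nonneg.2 (hx.grevilleNode_mem (by omega) hi.1 hi.2).2)
    (hx.bSpline_nonneg hi.1 hi.2 s)

theorem IsKnotSequence.tendsto_schoenbergSum (hx : IsKnotSequence n k x) (hn : 0 < n) (hk : 2 ≤ k)
    (f : ℝ → ℝ) : Tendsto (schoenbergSum n k x f) (𝓝[<] 1) (𝓝 (f 1)) := by
  have h : Tendsto (fun s => f 1 + ∑ j ∈ Finset.Ico (-(k : ℤ)) n,
      (f (grevilleNode k x j) - f 1) * bSpline k x j s) (𝓝[<] 1)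
      (𝓝 (f 1 + ∑ _j ∈ Finset.Ico (-(k : ℤ)) n, (0 : ℝ))) := by
    refine tendsto_const_nhds.add (tendsto_finsetSum _ fun j hj => ?_)
    rw [Finset.mem_Ico] at hj
    rcases (show j ≤ n - 1 by omega).eq_or_lt with rfl | hj'
    · simp only [hx.grevilleNode_last (by omega), sub_self, zero_mul]
      exact tendsto_const_nhds
    · simpa using (hx.tendsto_bSpline hn hk hj.1 hj').const_mul (f (grevilleNode k x j) - f 1)
  rw [Finset.sum_const_zero, add_zero] at h
  refine h.congr' ?_
  filter_upwards [Ico_mem_nhdsLT (zero_lt_one (α := ℝ))] with s hs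
  simp only [sub_mul]
  rw [Finset.sum_sub_distrib, ← Finset.mul_sum, hx.sum_bSpline hs.1 hs.2, mul_one,
    add_sub_cancel, schoenbergSum]

theorem IsKnotSequence.schoenberg_eq_sum (hx : IsKnotSequence n k x) (hn : 0 < n) (hk : 2 ≤ k)
    (f : ℝ → ℝ) {s : ℝ} (hs : s ≤ 1) :
    schoenberg n k x f s
      = ∑ j ∈ Finset.Ico (-(k : ℤ)) n, f (grevilleNode k x j) * schoenbergWeight n k x j s := by
  rcases hs.eq_or_lt with rfl | h
  · rw [sum_mul_schoenbergWeight_one hn (fun j => f (grevilleNode k x j)),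
      hx.grevilleNode_last (by omega), schoenberg, if_neg (lt_irrefl _)]
    exact (hx.tendsto_schoenbergSum hn hk f).limUnder_eq
  · simp only [schoenbergWeight_of_lt _ h, schoenberg, if_pos h, schoenbergSum]

theorem IsKnotSequence.schoenbergWeight_pred_pos (hx : IsKnotSequence n k x) (hn : 0 < n)
    (hk : 2 ≤ k) {j : ℤ} (h0 : -(k : ℤ) < j) (h1 : j < n - 1) :
    0 < schoenbergWeight n k x (j - 1) (grevilleNode k x j) := by
  rw [schoenbergWeight_of_lt _ (hx.grevilleNode_lt_one hn hk h0.le h1)]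
  obtain ⟨h2, h3⟩ := hx.lt_grevilleNode_lt hn hk h0 h1
  refine hx.bSpline_pos (by omega) (by omega) ?_ ?_
  · exact (hx.monotoneOn ⟨by omega, by omega⟩ ⟨by omega, by omega⟩ (by omega)).trans_lt h2
  · rwa [show j - 1 + (k : ℤ) + 1 = j + k by ring]

/-! ### Sequences fixed by the collocation matrix -/

/-- A maximum principle: a sequence that is fixed by a stochastic matrix with positive subdiagonal
in the interior rows, and is nonpositive at both ends, is nonpositive. At the first index of a
positive maximum, averaging would force the preceding entry to be maximal too. -/
theorem nonpos_of_fixed_of_stochastic {a b : ℤ} {A : ℤ → ℤ → ℝ} {w : ℤ → ℝ}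
    (hA : ∀ i ∈ Finset.Ico a b, ∀ j ∈ Finset.Ico a b, 0 ≤ A i j)
    (hsum : ∀ i ∈ Finset.Ico a b, ∑ j ∈ Finset.Ico a b, A i j = 1)
    (hpos : ∀ i, a < i → i < b - 1 → 0 < A i (i - 1))
    (hw : ∀ i ∈ Finset.Ico a b, w i = ∑ j ∈ Finset.Ico a b, w j * A i j)
    (ha : w a ≤ 0) (hb : w (b - 1) ≤ 0) : ∀ j ∈ Finset.Ico a b, w j ≤ 0 := by
  by_contra! hcon
  obtain ⟨j₀, hj₀, hj₀pos⟩ := hcon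
  obtain ⟨m, hm, hmax⟩ := Finset.exists_max_image (Finset.Ico a b) w ⟨j₀, hj₀⟩
  have hMpos : 0 < w m := hj₀pos.trans_le (hmax j₀ hj₀)
  obtain ⟨i, hi, himin⟩ := Finset.exists_min_image
    ((Finset.Ico a b).filter fun j => w j = w m) id ⟨m, by
      simp only [Finset.mem_filter, hm, true_and]⟩
  rw [Finset.mem_filter] at hi
  obtain ⟨hi, hwi⟩ := hi
  have hi' := Finset.mem_Ico.1 hi
  have hia : i ≠ a := by rintro rfl; linarith
  have hib : i ≠ b - 1 := by rintro rfl; linarith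
  have hmem : i - 1 ∈ Finset.Ico a b := Finset.mem_Ico.2 ⟨by omega, by omega⟩
  have hzero : ∑ j ∈ Finset.Ico a b, (w m - w j) * A i j = 0 := by
    simp only [sub_mul]
    rw [Finset.sum_sub_distrib, ← Finset.mul_sum, hsum i hi, ← hw i hi, hwi, mul_one, sub_self]
  have h := (Finset.sum_eq_zero_iff_of_nonneg fun j hj =>
    mul_nonneg (sub_nonneg.2 (hmax j hj)) (hA i hi j hj)).1 hzero (i - 1) hmem
  have h' := (mul_eq_zero.1 h).resolve_right (hpos i (by omega) (by omega)).ne'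
  have := himin (i - 1) (Finset.mem_filter.2 ⟨hmem, by linarith⟩)
  simp only [id] at this
  omega

/-- A sequence fixed by the collocation matrix of the B-splines at the Greville nodes is an affine
function of the nodes. -/
theorem IsKnotSequence.exists_affine_of_fixed (hx : IsKnotSequence n k x) (hn : 0 < n)
    (hk : 2 ≤ k) {w : ℤ → ℝ}
    (hw : ∀ i ∈ Finset.Ico (-(k : ℤ)) n, w i = ∑ j ∈ Finset.Ico (-(k : ℤ)) n,
      w j * schoenbergWeight n k x j (grevilleNode k x i)) :
    ∃ α β : ℝ, ∀ j ∈ Finset.Ico (-(k : ℤ)) n, w j = α + β * grevilleNode k x j := by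
  set α := w (-k) with hα
  set β := w (n - 1) - w (-k) with hβ
  have hξ : ∀ i ∈ Finset.Ico (-(k : ℤ)) n, grevilleNode k x i ∈ Icc (0 : ℝ) 1 := fun i hi =>
    hx.grevilleNode_mem (by omega) (Finset.mem_Ico.1 hi).1 (Finset.mem_Ico.1 hi).2
  have hfix : ∀ i ∈ Finset.Ico (-(k : ℤ)) n, w i - (α + β * grevilleNode k x i)
      = ∑ j ∈ Finset.Ico (-(k : ℤ)) n, (w j - (α + β * grevilleNode k x j))
        * schoenbergWeight n k x j (grevilleNode k x i) := by
    intro i hi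
    simp only [sub_mul, add_mul, mul_assoc]
    rw [Finset.sum_sub_distrib, Finset.sum_add_distrib, ← Finset.mul_sum, ← Finset.mul_sum,
      hx.sum_schoenbergWeight hn (hξ i hi),
      hx.sum_grevilleNode_mul_schoenbergWeight hn (by omega) (hξ i hi), ← hw i hi, mul_one]
  have hA : ∀ i ∈ Finset.Ico (-(k : ℤ)) n, ∀ j ∈ Finset.Ico (-(k : ℤ)) n,
      0 ≤ schoenbergWeight n k x j (grevilleNode k x i) :=
    fun i _ j hj => hx.schoenbergWeight_nonneg hj _
  have hle := nonpos_of_fixed_of_stochastic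
    (A := fun i j => schoenbergWeight n k x j (grevilleNode k x i)) hA
    (fun i hi => hx.sum_schoenbergWeight hn (hξ i hi))
    (fun i h0 h1 => hx.schoenbergWeight_pred_pos hn hk h0 h1) hfix
    (by simp [hx.grevilleNode_first (show 0 < k by omega), hα])
    (by simp [hx.grevilleNode_last (show 0 < k by omega), hα, hβ])
  have hge := nonpos_of_fixed_of_stochastic
    (A := fun i j => schoenbergWeight n k x j (grevilleNode k x i)) hA
    (fun i hi => hx.sum_schoenbergWeight hn (hξ i hi))
    (fun i h0 h1 => hx.schoenbergWeight_pred_pos hn hk h0 h1)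
    (w := fun i => -(w i - (α + β * grevilleNode k x i)))
    (fun i hi => by simp only [neg_mul, Finset.sum_neg_distrib, neg_inj]; exact hfix i hi)
    (by simp [hx.grevilleNode_first (show 0 < k by omega), hα])
    (by simp [hx.grevilleNode_last (show 0 < k by omega), hα, hβ])
  refine ⟨α, β, fun j hj => ?_⟩
  linarith [hle j hj, hge j hj]

/-! ### Distance to the affine functions -/

theorem exists_norm_preimage_le {E F : Type*} [NormedAddCommGroup E] [NormedSpace ℝ E]
    [NormedAddCommGroup F] [NormedSpace ℝ F] [FiniteDimensional ℝ E] (T : E →ₗ[ℝ] F) :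
    ∃ K : ℝ, 0 ≤ K ∧ ∀ c, ∃ c', T c' = T c ∧ ‖c'‖ ≤ K * ‖T c‖ := by
  obtain ⟨S, hS⟩ := T.rangeRestrict.exists_rightInverse_of_surjective T.range_rangeRestrict
  refine ⟨‖LinearMap.toContinuousLinearMap S‖, ContinuousLinearMap.opNorm_nonneg _, fun c =>
    ⟨S (T.rangeRestrict c), ?_, (LinearMap.toContinuousLinearMap S).le_opNorm _⟩⟩
  exact congrArg Subtype.val (LinearMap.congr_fun hS (T.rangeRestrict c))

/-- `f - S f` controls the distance of `f` to the affine functions, because the coefficient vector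
of `S f` is determined, modulo affine sequences, by the values of `f - S f` at the nodes. -/
theorem IsKnotSequence.exists_affine_approx (hx : IsKnotSequence n k x) (hn : 0 < n)
    (hk : 2 ≤ k) : ∃ K : ℝ, 0 ≤ K ∧ ∀ (f : ℝ → ℝ) (G : ℝ),
      (∀ s ∈ Icc (0 : ℝ) 1, |f s - schoenberg n k x f s| ≤ G) →
      ∃ α β : ℝ, ∀ s ∈ Icc (0 : ℝ) 1, |f s - (α + β * s)| ≤ (1 + K) * G := by
  set I := Finset.Ico (-(k : ℤ)) n with hI
  have hξ : ∀ i ∈ I, grevilleNode k x i ∈ Icc (0 : ℝ) 1 := fun i hi =>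
    hx.grevilleNode_mem (by omega) (Finset.mem_Ico.1 hi).1 (Finset.mem_Ico.1 hi).2
  -- `T` is the identity minus the collocation matrix.
  let T : (I → ℝ) →ₗ[ℝ] (I → ℝ) := LinearMap.pi fun i =>
    LinearMap.proj i - ∑ j : I, schoenbergWeight n k x j (grevilleNode k x i) • LinearMap.proj j
  have hT : ∀ (c : ℤ → ℝ) (i : I), T (fun j => c j) i
      = c i - ∑ j ∈ I, c j * schoenbergWeight n k x j (grevilleNode k x i) := by
    intro c i
    simp only [T, LinearMap.pi_apply, LinearMap.sub_apply, LinearMap.proj_apply,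
      LinearMap.sum_apply, LinearMap.smul_apply, smul_eq_mul]
    rw [← Finset.sum_coe_sort I]
    simp only [mul_comm]
  obtain ⟨K, hK0, hK⟩ := exists_norm_preimage_le T
  refine ⟨K, hK0, fun f G hG => ?_⟩
  have hG0 : 0 ≤ G := (abs_nonneg _).trans (hG 0 ⟨le_rfl, zero_le_one⟩)
  obtain ⟨c', hc', hnorm⟩ := hK fun j => f (grevilleNode k x j)
  have hTf : ‖T fun j => f (grevilleNode k x j)‖ ≤ G := by
    refine (pi_norm_le_iff_of_nonneg hG0).2 fun i => ?_
    rw [hT (fun j => f (grevilleNode k x j)), Real.norm_eq_abs,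
      ← hx.schoenberg_eq_sum hn hk f (hξ i i.2).2]
    exact hG _ (hξ i i.2)
  set c : ℤ → ℝ := fun j => if h : j ∈ I then c' ⟨j, h⟩ else 0 with hc
  have hcc : (fun j : I => c j) = c' := by
    funext j
    simp only [hc, j.2, dite_true]
  have hcle : ∀ j ∈ I, |c j| ≤ K * G := by
    intro j hj
    have := (norm_le_pi_norm c' ⟨j, hj⟩).trans
      (hnorm.trans (mul_le_mul_of_nonneg_left hTf hK0))
    rwa [← hcc, Real.norm_eq_abs] at this
  obtain ⟨α, β, hαβ⟩ := hx.exists_affine_of_fixed hn hk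
    (w := fun j => f (grevilleNode k x j) - c j) (fun i hi => by
      have := congrFun hc' ⟨i, hi⟩
      rw [← hcc, hT, hT (fun j => f (grevilleNode k x j))] at this
      simp only [sub_mul]
      rw [Finset.sum_sub_distrib]
      linarith)
  -- By `hαβ`, `S f` is an affine function plus the spline with the bounded coefficients `c`.
  refine ⟨α, β, fun s hs => ?_⟩
  have hsplit : f s - (α + β * s) = (f s - schoenberg n k x f s)
      + ∑ j ∈ I, c j * schoenbergWeight n k x j s := by
    have h1 : ∑ j ∈ I, c j * schoenbergWeight n k x j s = schoenberg n k x f s - (α + β * s) := by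
      have h2 : ∀ j ∈ I, c j * schoenbergWeight n k x j s
          = f (grevilleNode k x j) * schoenbergWeight n k x j s
            - (α * schoenbergWeight n k x j s
              + β * (grevilleNode k x j * schoenbergWeight n k x j s)) := by
        intro j hj
        linear_combination -schoenbergWeight n k x j s * hαβ j hj
      rw [Finset.sum_congr rfl h2, Finset.sum_sub_distrib, Finset.sum_add_distrib,
        ← Finset.mul_sum, ← Finset.mul_sum, hx.sum_schoenbergWeight hn hs,
        hx.sum_grevilleNode_mul_schoenbergWeight hn (by omega) hs,
        ← hx.schoenberg_eq_sum hn hk f hs.2, mul_one]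
    rw [h1]; ring
  rw [hsplit, one_add_mul]
  exact (abs_add_le _ _).trans
    (add_le_add (hG s hs) (hx.abs_sum_mul_schoenbergWeight_le hn hcle hs))

/-- Continuity of `f` makes `f - S f` bounded on `[0, 1]`, so that `uniformNorm` is a genuine
supremum. -/
theorem IsKnotSequence.abs_sub_schoenberg_le_uniformNorm (hx : IsKnotSequence n k x) (hn : 0 < n)
    (hk : 2 ≤ k) {f : ℝ → ℝ} (hf : ContinuousOn f (Icc 0 1)) {s : ℝ} (hs : s ∈ Icc (0 : ℝ) 1) :
    |f s - schoenberg n k x f s| ≤ uniformNorm fun s => f s - schoenberg n k x f s := by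
  obtain ⟨B, hB⟩ := isCompact_Icc.exists_bound_of_continuousOn hf
  refine le_csSup ⟨B + B, ?_⟩ (mem_image_of_mem _ hs)
  rintro _ ⟨u, hu, rfl⟩
  refine (abs_sub _ _).trans (add_le_add (hB u hu) ?_)
  rw [hx.schoenberg_eq_sum hn hk f hu.2]
  exact hx.abs_sum_mul_schoenbergWeight_le hn (fun j hj => hB _
    (hx.grevilleNode_mem (by omega) (Finset.mem_Ico.1 hj).1 (Finset.mem_Ico.1 hj).2)) hu

end Weights

/-! ### Forward differences -/

theorem forwardDifference_eq_fwdDiff (r : ℕ) (h : ℝ) (f : ℝ → ℝ) (s : ℝ) :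
    forwardDifference r h f s = (fwdDiff h)^[r] f s := by
  rw [fwdDiff_iter_eq_sum_shift, forwardDifference]
  refine Finset.sum_congr rfl fun l _ => ?_
  simp [zsmul_eq_mul, nsmul_eq_mul]

theorem forwardDifference_sub_affine {r : ℕ} (hr : 2 ≤ r) (h : ℝ) (f : ℝ → ℝ) (α β s : ℝ) :
    forwardDifference r h (fun u => f u - (α + β * u)) s = forwardDifference r h f s := by
  obtain ⟨m, rfl⟩ := Nat.exists_eq_add_of_le' hr
  have h0 : (fwdDiff h)^[m + 2] (fun u => α + β * u) = fun _ => 0 := by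
    have h1 : fwdDiff h (fun u => α + β * u) = fun _ => β * h := by
      funext u; simp only [fwdDiff]; ring
    rw [Function.iterate_succ_apply, h1, Function.iterate_succ_apply, fwdDiff_const]
    exact Function.iterate_fixed (fwdDiff_const h (0 : ℝ)) m
  have h2 : f = (fun u => f u - (α + β * u)) + fun u => α + β * u := by
    funext u; simp
  rw [forwardDifference_eq_fwdDiff, forwardDifference_eq_fwdDiff]
  conv_rhs => rw [h2, fwdDiff_iter_add, h0]
  simp

theorem abs_forwardDifference_le {r : ℕ} {h s B : ℝ} {g : ℝ → ℝ}
    (hg : ∀ l ∈ Finset.range (r + 1), |g (s + l * h)| ≤ B) :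
    |forwardDifference r h g s| ≤ 2 ^ r * B := by
  refine (Finset.abs_sum_le_sum_abs _ _).trans ?_
  have h2 : (2 : ℝ) ^ r = ∑ l ∈ Finset.range (r + 1), (r.choose l : ℝ) := by
    exact_mod_cast (Nat.sum_range_choose r).symm
  rw [h2, Finset.sum_mul]
  refine Finset.sum_le_sum fun l hl => ?_
  rw [abs_mul, abs_mul, abs_pow, abs_neg, abs_one, one_pow, one_mul, Nat.abs_cast]
  exact mul_le_mul_of_nonneg_left (hg l hl) (Nat.cast_nonneg _)

theorem modulusOfSmoothness_le_of_affine_approx {r : ℕ} (hr : 2 ≤ r) {f : ℝ → ℝ} {α β B : ℝ}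
    (h : ∀ s ∈ Icc (0 : ℝ) 1, |f s - (α + β * s)| ≤ B) (t : ℝ) :
    modulusOfSmoothness r f t ≤ 2 ^ r * B := by
  have hB : 0 ≤ B := (abs_nonneg _).trans (h 0 ⟨le_rfl, zero_le_one⟩)
  -- The set may be empty, with supremum `0`; the bound is nonnegative.
  refine Real.sSup_le ?_ (by positivity)
  rintro _ ⟨δ, hδ, s, hs, rfl⟩
  rw [← forwardDifference_sub_affine hr δ f α β]
  refine abs_forwardDifference_le fun l hl => h _ ?_
  have hl' : (l : ℝ) ≤ r := by exact_mod_cast Nat.lt_succ_iff.1 (Finset.mem_range.1 hl)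
  have h1 : (l : ℝ) * δ ≤ r * δ := mul_le_mul_of_nonneg_right hl' hδ.1.le
  have h2 : 0 ≤ (l : ℝ) * δ := mul_nonneg (Nat.cast_nonneg _) hδ.1.le
  exact ⟨by linarith [hs.1], by linarith [hs.2]⟩

end

theorem mainTheorem3 (n k r : ℕ) (hn : 0 < n) (hr : 2 ≤ r) (hk : r < k)
    (x : ℤ → ℝ) (hx : IsKnotSequence n k x) (t : ℝ) (ht0 : 0 < t) (ht1 : t ≤ 1 / (r : ℝ)) :
    ∃ M : ℝ, 0 < M ∧ ∀ f : ℝ → ℝ, ContinuousOn f (Icc 0 1) →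
      M * modulusOfSmoothness r f t ≤ uniformNorm (fun s => f s - schoenberg n k x f s) := by
  obtain ⟨K, hK0, hK⟩ := hx.exists_affine_approx hn (by omega)
  have hpos : 0 < 2 ^ r * (1 + K) := by positivity
  refine ⟨(2 ^ r * (1 + K))⁻¹, inv_pos.2 hpos, fun f hf => ?_⟩
  obtain ⟨α, β, hαβ⟩ := hK f _ fun s hs =>
    hx.abs_sub_schoenberg_le_uniformNorm hn (by omega) hf hs
  rw [inv_mul_le_iff₀ hpos, mul_assoc]
  exact modulusOfSmoothness_le_of_affine_approx hr hαβ t
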